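/- Let $n\ge 1$. A Dyck path of order $n$ is a lattice path from $(0,0)$ to $(2n,0)$ with $n$ up steps $(1,1)$ and $n$ down steps $(1,-1)$ that never goes below the $x$-axis; let $D(n)$ be the set of these paths. For $p\in D(n)$ let $\operatorname{area}(p)$ be the number of points $(x,y)\in\mathbb Z^2$ with $x+y$ even that lie strictly below $p$ and on or above the line $y=0$. Let $NC(n)$ be the set of noncrossing partitions of $\{1,\dots,n\}$, partially ordered so that $\pi\le\pi'$ if every block of $\pi$ is contained in a block of $\pi'$. Let $\phi:D(n)\to NC(n)$ be Stump's bijection: $i$ and $i'$ lie in the same block of $\phi(p)$ if and only if the points of $p$ with abscissas $2i-1$ and $2i'-1$ have the same height and the segment of $p$ between them does not pass below that height. Order $D(n)$ by $p\le p'$ if and only if $\phi(p)\le\phi(p')$ in $NC(n)$, let $\operatorname{rk}(p)$ be the rank of $p$ in this poset (the maximal length of a chain with largest element $p$), and put $$D(n;q,t)=\sum_{p\in D(n)}q^{\operatorname{area}(p)}t^{\operatorname{rk}(p)}.$$ For $\sigma$ in the symmetric group $S_n$ let $\ell(\sigma)$ be its Coxeter length (the least number of adjacent transpositions $(i\ i{+}1)$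 with product $\sigma$) and $\ell'(\sigma)$ its reflection length (the least number of arbitrary transpositions with product $\sigma$). The absolute order on $S_n$ is given by $\sigma\le\tau$ if and only if $\ell'(\tau)=\ell'(\sigma)+\ell'(\sigma^{-1}\tau)$. Then $$D(n;q,t)=\sum_{\sigma\in[e,(12\cdots n)]}q^{\ell(\sigma)}t^{\ell'(\sigma)},$$ where $[e,(12\cdots n)]$ is the interval of the absolute order between the identity $e$ and the $n$-cycle $(12\cdots n)$. -/

import Mathlib

namespace NCDyck

/-! ### Noncrossing partitions -/

/-- A set partition of `{1, …, n}` (here `Fin n`), given as an equivalence relation whose classes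
are the blocks, is noncrossing if no two distinct blocks `B`, `B'` contain pairs `a < b` in `B` and
`a' < b'` in `B'` with `a < a' < b < b'`. -/
def IsNoncrossing {n : ℕ} (π : Setoid (Fin n)) : Prop :=
  ∀ a a' b b' : Fin n, a < a' → a' < b → b < b' → π a b → π a' b' → π a a'

/-- `NC(n)`, ordered by refinement: `π ≤ π'` iff every block of `π` lies in a block of `π'`, so the
partition into singletons is the minimum (this is Mathlib's order on `Setoid`). -/
abbrev NC (n : ℕ) : Type := {π : Setoid (Fin n) // IsNoncrossing π}

/-! ### Dyck paths -/

/-- Dyck paths of order `n`, i.e. with `n` up steps and `n` down steps.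
A `def`, so that it does not inherit the (unrelated) order that Mathlib puts on `DyckWord`. -/
def DyckPath (n : ℕ) : Type := {p : DyckWord // p.semilength = n}

noncomputable instance (n : ℕ) : Fintype (DyckPath n) :=
  inferInstanceAs (Fintype {p : DyckWord // p.semilength = n})

namespace DyckPath

variable {n : ℕ}

/-- The height of the path after `x` steps: `(x, p.height x)` is the point of `p` at abscissa `x`,
for `0 ≤ x ≤ 2n`. -/
def height (p : DyckPath n) (x : ℕ) : ℤ :=
  ((p.1.toList.take x).count DyckStep.U : ℤ) - ((p.1.toList.take x).count DyckStep.D : ℤ)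

/-- The number of lattice points `(x, y)` (points with `x + y` even, the lattice on which the paths
run) strictly below the path and on or above the `x`-axis. Heights never exceed `n`. -/
def area (p : DyckPath n) : ℕ :=
  ((Finset.range (2 * n + 1) ×ˢ Finset.range (n + 1)).filter
    fun P : ℕ × ℕ => Even (P.1 + P.2) ∧ (P.2 : ℤ) < p.height P.1).card

/-- The vertex labelled `i` is the point of the path at abscissa `2 * i + 1` (labels start at `0`
here). Two labels are related iff their vertices have the same height and the part of the path
between them does not pass below that height. -/
def Sees (p : DyckPath n) (i j : Fin n) : Prop :=
  p.height (2 * i + 1) = p.height (2 * j + 1) ∧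
    ∀ x : ℕ, min (2 * (i : ℕ) + 1) (2 * j + 1) ≤ x → x ≤ max (2 * (i : ℕ) + 1) (2 * j + 1) →
      p.height (2 * i + 1) ≤ p.height x

/-- The set partition attached to a Dyck path. -/
def partition (p : DyckPath n) : Setoid (Fin n) where
  r := p.Sees
  iseqv :=
    { refl := fun i => ⟨rfl, fun x h₁ h₂ => by
        have : x = 2 * (i : ℕ) + 1 := by omega
        rw [this]⟩
      symm := fun {i j} h => ⟨h.1.symm, fun x h₁ h₂ => by
        rw [← h.1]
        exact h.2 x (by omega) (by omega)⟩
      trans := fun {i j k} h g => ⟨h.1.trans g.1, fun x h₁ h₂ => by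
        by_cases hx : min (2 * (i : ℕ) + 1) (2 * j + 1) ≤ x ∧ x ≤ max (2 * (i : ℕ) + 1) (2 * j + 1)
        · exact h.2 x hx.1 hx.2
        · rw [h.1]
          exact g.2 x (by omega) (by omega)⟩ }

theorem partition_isNoncrossing (p : DyckPath n) : IsNoncrossing p.partition := by
  intro a a' b b' h₁ h₂ h₃ hab hab'
  have g₁ : (a : ℕ) < a' := h₁
  have g₂ : (a' : ℕ) < b := h₂
  have g₃ : (b : ℕ) < b' := h₃
  have k₁ := hab.2 (2 * a' + 1) (by omega) (by omega)
  have k₂ := hab'.2 (2 * b + 1) (by omega) (by omega)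
  refine ⟨le_antisymm k₁ (k₂.trans hab.1.ge), fun x h₁ h₂ => hab.2 x (by omega) (by omega)⟩

/-- Stump's bijection `φ` from Dyck paths of order `n` to noncrossing partitions. -/
def phi (p : DyckPath n) : NC n := ⟨p.partition, p.partition_isNoncrossing⟩

/-- The order on Dyck paths inherited from `NC(n)`: `p ≤ q` iff `φ(p) ≤ φ(q)`. -/
instance : Preorder (DyckPath n) := Preorder.lift phi

/-- The rank of `p` in the poset of Dyck paths of order `n`: the maximal length of a strictly
increasing chain ending at `p`. -/
noncomputable def rk (p : DyckPath n) : ℕ := (Order.height p).toNat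

end DyckPath

/-- The generating function `D(n; q, t)` of Dyck paths of order `n` by area and rank. -/
noncomputable def genFun {R : Type*} [CommSemiring R] (n : ℕ) (q t : R) : R :=
  ∑ p : DyckPath n, q ^ p.area * t ^ p.rk

/-! ### The symmetric group -/

/-- The least number of factors in an expression of `g` as a product of elements of `S`
(used only for sets `S`, closed under inversion, that generate the group). -/
noncomputable def wordLength {G : Type*} [Group G] (S : Set G) (g : G) : ℕ :=
  sInf {k | ∃ w : List G, (∀ s ∈ w, s ∈ S) ∧ w.prod = g ∧ w.length = k}

/-- Coxeter length `ℓ` on `S_n`, with respect to the adjacent transpositions `(i, i + 1)`. -/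
noncomputable def length {n : ℕ} (σ : Equiv.Perm (Fin n)) : ℕ :=
  wordLength {s | ∃ i j : Fin n, (i : ℕ) + 1 = j ∧ s = Equiv.swap i j} σ

/-- Reflection length `ℓ'` on `S_n`, with respect to all transpositions. -/
noncomputable def reflLength {n : ℕ} (σ : Equiv.Perm (Fin n)) : ℕ :=
  wordLength {s | s.IsSwap} σ

/-- The absolute order on `S_n`. -/
def AbsLE {n : ℕ} (σ τ : Equiv.Perm (Fin n)) : Prop :=
  reflLength τ = reflLength σ + reflLength (σ⁻¹ * τ)

open Classical in
/-- The interval `[σ, τ]` of the absolute order on `S_n`. -/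
noncomputable def absInterval {n : ℕ} (σ τ : Equiv.Perm (Fin n)) :
    Finset (Equiv.Perm (Fin n)) :=
  Finset.univ.filter fun ρ => AbsLE σ ρ ∧ AbsLE ρ τ

end NCDyck

/-!
A noncrossing partition `π` of `Fin n` is encoded by the permutation `σ` whose cycles are its blocks
in increasing order (`IsSuccPerm π σ`). The two statistics on Dyck paths are those of `σ` for
`π = phi p`.

*The interval.* Let `nonmins π` be `n` minus the number of blocks. If `i < j` lie in one block of
`π`, then `σ * swap i j` belongs to the noncrossing partition obtained by cutting that block along
`(i, j]` (`IsSuccPerm.split`), and every noncrossing partition other than `⊤` arises by such a cut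
(`exists_eq_split`). A product of `k` transpositions preserves the blocks of a partition with
`nonmins ≤ k`, got by merging blocks (`exists_setoid_of_word`). Together these give
`reflLength σ = nonmins π`, that `σ` lies below the long cycle, and, descending from the long cycle
one transposition at a time, that everything below it is of this form
(`exists_isSuccPerm_of_absLE`).

*The paths.* Every permutation `σ` gives a Dyck path `DyckPath.ofPerm σ` whose height at abscissa
`2 * k` is twice the number of arcs `a < k ≤ σ a`, and at abscissa `2 * k + 1` one more than twice
the number of arcs `a < k < σ a`. For `σ` attached to `π`, the partition of this path is `π`
(`IsSuccPerm.phi_ofPerm`). Conversely the steps of a path can be read off from the block minima and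
maxima of its partition (`DyckPath.phi_injective`), so `phi` is a bijection. The rank is then
`nonmins (phi p)`, by strict monotonicity of `nonmins` and because a cut lowers it by one.

*Area and length.* The area is the sum of the halved heights, that is, the number of arcs over
points plus the number of arcs over gaps. The length of `σ` is its number of inversions, and the
number of inversions `(a, b)` with given right end `b` is the number of arcs over `b` plus the
truncated difference `b - σ b` (`IsSuccPerm.card_inversions_right`). The sum of these differences is
`∑ (σ a - a)`, again truncated, which counts the arcs over gaps.
-/

namespace NCDyck

open Equiv

variable {n : ℕ}

/-! ### Counting the elements that are not minimal in their block -/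

open Classical in
/-- The number of elements that are not the least of their block, i.e. `n` minus the number of
blocks of `π`. -/
noncomputable def nonmins (π : Setoid (Fin n)) : ℕ :=
  (Finset.univ.filter fun i => ∃ j, j < i ∧ π j i).card

theorem nonmins_mono {π π' : Setoid (Fin n)} (h : π ≤ π') : nonmins π ≤ nonmins π' := by
  classical
  refine Finset.card_le_card fun i hi => ?_
  simp only [Finset.mem_filter, Finset.mem_univ, true_and] at hi ⊢
  obtain ⟨j, hj, hji⟩ := hi
  exact ⟨j, hj, h hji⟩

theorem exists_le_forall_le (π : Setoid (Fin n)) (x : Fin n) :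
    ∃ m, m ≤ x ∧ π m x ∧ ∀ y, π y x → m ≤ y := by
  classical
  have hne : (Finset.univ.filter fun y => π y x).Nonempty := ⟨x, by simp⟩
  obtain ⟨m, hm, hmin⟩ := Finset.exists_min_image _ (fun y => y) hne
  simp only [Finset.mem_filter, Finset.mem_univ, true_and] at hm hmin
  exact ⟨m, hmin x (π.refl x), hm, hmin⟩

theorem exists_ge_forall_ge (π : Setoid (Fin n)) (x : Fin n) :
    ∃ m, x ≤ m ∧ π m x ∧ ∀ y, π y x → y ≤ m := by
  classical
  have hne : (Finset.univ.filter fun y => π y x).Nonempty := ⟨x, by simp⟩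
  obtain ⟨m, hm, hmax⟩ := Finset.exists_max_image _ (fun y => y) hne
  simp only [Finset.mem_filter, Finset.mem_univ, true_and] at hm hmax
  exact ⟨m, hmax x (π.refl x), hm, hmax⟩

/-- If `π ≤ π'` have the same number of blocks, they have the same block minima; two
`π'`-equivalent `π`-minima are then both the minimum of one block of `π'`. -/
theorem eq_of_le_of_nonmins_le {π π' : Setoid (Fin n)} (h : π ≤ π')
    (hc : nonmins π' ≤ nonmins π) : π = π' := by
  classical
  have hs := Finset.eq_of_subset_of_card_le
    (s := Finset.univ.filter fun i => ∃ j, j < i ∧ π j i)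
    (t := Finset.univ.filter fun i => ∃ j, j < i ∧ π' j i)
    (fun i hi => by
      simp only [Finset.mem_filter, Finset.mem_univ, true_and] at hi ⊢
      obtain ⟨j, hj, hji⟩ := hi
      exact ⟨j, hj, h hji⟩) hc
  have key : ∀ i, (∃ j, j < i ∧ π' j i) → ∃ j, j < i ∧ π j i := fun i hi => by
    have : i ∈ Finset.univ.filter fun i => ∃ j, j < i ∧ π j i := by
      rw [hs]; simpa using hi
    simpa using this
  refine le_antisymm h fun {x y} hxy => ?_
  obtain ⟨a, -, hax, ha⟩ := exists_le_forall_le π x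
  obtain ⟨b, -, hby, hb⟩ := exists_le_forall_le π y
  have hab : π' a b := π'.trans (h hax) (π'.trans hxy (π'.symm (h hby)))
  rcases lt_trichotomy a b with hlt | rfl | hlt
  · obtain ⟨j, hj, hjb⟩ := key b ⟨a, hlt, hab⟩
    exact absurd (hb j (π.trans hjb hby)) (not_le.2 hj)
  · exact π.trans (π.symm hax) hby
  · obtain ⟨j, hj, hja⟩ := key a ⟨b, hlt, π'.symm hab⟩
    exact absurd (ha j (π.trans hja hax)) (not_le.2 hj)

theorem nonmins_strictMono : StrictMono (nonmins (n := n)) := fun _ _ h =>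
  lt_of_not_ge fun hc => h.ne (eq_of_le_of_nonmins_le h.le hc)

theorem nonmins_bot : nonmins (⊥ : Setoid (Fin n)) = 0 := by
  classical
  refine Finset.card_eq_zero.2 (Finset.filter_eq_empty_iff.2 ?_)
  rintro i - ⟨j, hj, hji⟩
  exact hj.ne hji

theorem nonmins_le (π : Setoid (Fin n)) : nonmins π ≤ n - 1 := by
  classical
  cases n with
  | zero => simp [nonmins]
  | succ n =>
    have : nonmins π ≤ (Finset.univ.erase (0 : Fin (n + 1))).card := by
      refine Finset.card_le_card fun i hi => ?_
      simp only [Finset.mem_filter, Finset.mem_univ, true_and] at hi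
      obtain ⟨j, hj, -⟩ := hi
      simp only [Finset.mem_erase, Finset.mem_univ, and_true]
      exact (lt_of_le_of_lt (Fin.zero_le j) hj).ne'
    simpa using this

theorem nonmins_top : nonmins (⊤ : Setoid (Fin n)) = n - 1 := by
  classical
  refine le_antisymm (nonmins_le _) ?_
  cases n with
  | zero => exact Nat.zero_le _
  | succ n =>
    have : (Finset.univ.erase (0 : Fin (n + 1))).card ≤ nonmins (⊤ : Setoid (Fin (n + 1))) := by
      refine Finset.card_le_card fun i hi => ?_
      simp only [Finset.mem_erase, Finset.mem_univ, and_true] at hi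
      simp only [Finset.mem_filter, Finset.mem_univ, true_and]
      exact ⟨0, Fin.pos_iff_ne_zero.2 hi, trivial⟩
    simpa using this

open Classical in
/-- The partition obtained from `π` by merging the blocks of `i` and `j`. -/
noncomputable def merge (π : Setoid (Fin n)) (i j : Fin n) : Setoid (Fin n) :=
  π.comap fun a => if π a j then i else a

theorem merge_apply {π : Setoid (Fin n)} {i j a b : Fin n} : merge π i j a b ↔
    π a b ∨ (π a i ∨ π a j) ∧ (π b i ∨ π b j) := by
  classical
  have s := @π.symm'
  have t := @π.trans'
  have r := @π.refl'
  change π (if π a j then i else a) (if π b j then i else b) ↔ _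
  constructor
  · intro h
    split_ifs at h with h1 h2 h2
    · exact Or.inr ⟨Or.inr h1, Or.inr h2⟩
    · exact Or.inr ⟨Or.inr h1, Or.inl (s h)⟩
    · exact Or.inr ⟨Or.inl h, Or.inr h2⟩
    · exact Or.inl h
  · intro h
    split_ifs with h1 h2 h2
    · exact r _
    · rcases h with h | ⟨-, h | h⟩
      · exact absurd (t (s h) h1) h2
      · exact s h
      · exact absurd h h2
    · rcases h with h | ⟨h | h, -⟩
      · exact absurd (t h h2) h1
      · exact h
      · exact absurd h h1
    · rcases h with h | ⟨h | h, h' | h'⟩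
      · exact h
      · exact t h (s h')
      · exact absurd h' h2
      · exact absurd h h1
      · exact absurd h h1

theorem le_merge (π : Setoid (Fin n)) (i j : Fin n) : π ≤ merge π i j := fun {_ _} h =>
  merge_apply.2 (Or.inl h)

theorem merge_left_right (π : Setoid (Fin n)) (i j : Fin n) : merge π i j i j :=
  merge_apply.2 (Or.inr ⟨Or.inl (π.refl i), Or.inr (π.refl j)⟩)

/-- Only the larger of the two minima of the merged blocks ceases to be a block minimum. -/
theorem nonmins_merge_le (π : Setoid (Fin n)) (i j : Fin n) :
    nonmins (merge π i j) ≤ nonmins π + 1 := by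
  classical
  have s := @π.symm'
  have t := @π.trans'
  -- `a` and `b` with `a < b` cannot both be new nonminima: the element `c < a` of the other merged
  -- block lies in the block of `b`, whose minimum is `b`
  have key : ∀ a b : Fin n, a < b → (∃ c, c < a ∧ merge π i j c a) → (¬ ∃ c, c < a ∧ π c a) →
      (∃ c, c < b ∧ merge π i j c b) → (¬ ∃ c, c < b ∧ π c b) → False := by
    rintro a b hab ⟨c, hca, hc⟩ ha ⟨d, hdb, hd⟩ hb
    have hca' : ¬ π c a := fun h => ha ⟨c, hca, h⟩
    have hdb' : ¬ π d b := fun h => hb ⟨d, hdb, h⟩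
    have hcb' : ¬ π c b := fun h => hb ⟨c, hca.trans hab, h⟩
    have hab' : ¬ π a b := fun h => hb ⟨a, hab, h⟩
    rw [merge_apply] at hc hd
    grind
  set A := Finset.univ.filter fun a => ∃ c, c < a ∧ merge π i j c a with hA
  set B := Finset.univ.filter fun a => ∃ c, c < a ∧ π c a with hB
  have h1 : (A \ B).card ≤ 1 := by
    refine Finset.card_le_one.2 fun a ha b hb => ?_
    simp only [hA, hB, Finset.mem_sdiff, Finset.mem_filter, Finset.mem_univ, true_and] at ha hb
    rcases lt_trichotomy a b with h | h | h
    · exact (key a b h ha.1 ha.2 hb.1 hb.2).elim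
    · exact h
    · exact (key b a h hb.1 hb.2 ha.1 ha.2).elim
  have h2 : A.card ≤ (A \ B).card + B.card := by
    have := Finset.le_card_sdiff B A
    omega
  change A.card ≤ B.card + 1
  omega

/-! ### Word length and reflection length -/

theorem wordLength_le {G : Type*} [Group G] {S : Set G} (w : List G) (hw : ∀ s ∈ w, s ∈ S) :
    wordLength S w.prod ≤ w.length :=
  Nat.sInf_le ⟨w, hw, rfl, rfl⟩

theorem exists_word {G : Type*} [Group G] {S : Set G} {g : G}
    (h : ∃ w : List G, (∀ s ∈ w, s ∈ S) ∧ w.prod = g) :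
    ∃ w : List G, (∀ s ∈ w, s ∈ S) ∧ w.prod = g ∧ w.length = wordLength S g := by
  obtain ⟨w, hw, hg⟩ := h
  exact Nat.sInf_mem (s := {k | ∃ w : List G, (∀ s ∈ w, s ∈ S) ∧ w.prod = g ∧ w.length = k})
    ⟨w.length, w, hw, hg, rfl⟩

theorem exists_swap_word (σ : Perm (Fin n)) :
    ∃ w : List (Perm (Fin n)), (∀ s ∈ w, s.IsSwap) ∧ w.prod = σ ∧ w.length = reflLength σ :=
  exists_word (S := {s : Perm (Fin n) | s.IsSwap})
    ⟨(Perm.swapFactors σ).1, (Perm.swapFactors σ).2.2, (Perm.swapFactors σ).2.1⟩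

theorem reflLength_prod_le (w : List (Perm (Fin n))) (hw : ∀ s ∈ w, s.IsSwap) :
    reflLength w.prod ≤ w.length :=
  wordLength_le w hw

theorem reflLength_one : reflLength (1 : Perm (Fin n)) = 0 :=
  Nat.le_zero.1 (reflLength_prod_le [] (by simp))

theorem reflLength_mul_le (σ τ : Perm (Fin n)) :
    reflLength (σ * τ) ≤ reflLength σ + reflLength τ := by
  obtain ⟨v, hv, rfl, hvl⟩ := exists_swap_word σ
  obtain ⟨w, hw, rfl, hwl⟩ := exists_swap_word τ
  rw [← List.prod_append, ← hvl, ← hwl, ← List.length_append]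
  exact reflLength_prod_le _ fun s hs => (List.mem_append.1 hs).elim (hv s) (hw s)

theorem reflLength_swap_le {i j : Fin n} (h : i ≠ j) : reflLength (swap i j) ≤ 1 := by
  simpa using reflLength_prod_le [swap i j] (by simpa using ⟨i, j, h, rfl⟩)

/-- Merging, for each factor of a product of transpositions, the blocks of the two points it
exchanges gives a partition preserved by the product. -/
theorem exists_setoid_of_word (w : List (Perm (Fin n))) (hw : ∀ s ∈ w, s.IsSwap) :
    ∃ S : Setoid (Fin n), (∀ s ∈ w, ∀ x, S x (s x)) ∧ (∀ x, S x (w.prod x)) ∧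
      nonmins S ≤ w.length := by
  induction w with
  | nil => exact ⟨⊥, by simp, fun x => rfl, by simp [nonmins_bot]⟩
  | cons s w ih =>
    obtain ⟨S, h1, h2, h3⟩ := ih fun s hs => hw s (List.mem_cons_of_mem _ hs)
    obtain ⟨i, j, hij, rfl⟩ := hw s List.mem_cons_self
    have hs : ∀ x, merge S i j x (swap i j x) := fun x => by
      by_cases hi : x = i
      · subst hi; rw [swap_apply_left]; exact merge_left_right S x j
      by_cases hj : x = j
      · subst hj; rw [swap_apply_right]; exact (merge S i x).symm (merge_left_right S i x)
      rw [swap_apply_of_ne_of_ne hi hj]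
    refine ⟨merge S i j, fun s' hs' x => ?_, fun x => ?_, ?_⟩
    · rcases List.mem_cons.1 hs' with rfl | hs'
      · exact hs x
      · exact le_merge S i j (h1 s' hs' x)
    · rw [List.prod_cons, Perm.mul_apply]
      exact (merge S i j).trans (le_merge S i j (h2 x)) (hs _)
    · have := nonmins_merge_le S i j
      rw [List.length_cons]; omega

/-! ### The permutation attached to a partition -/

/-- `σ` is the permutation whose cycles are the blocks of `π` in increasing order: it sends each
element to the next larger one of its block, and the largest of a block to the smallest. -/
structure IsSuccPerm (π : Setoid (Fin n)) (σ : Perm (Fin n)) : Prop where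
  rel : ∀ x, π x (σ x)
  next : ∀ x y, π x y → x < y → x < σ x ∧ σ x ≤ y
  wrap : ∀ x y, π x y → σ x ≤ x → σ x ≤ y

namespace IsSuccPerm

variable {π π' : Setoid (Fin n)} {σ σ' : Perm (Fin n)}

/-- A partition is the finest one preserved by its permutation. -/
theorem le_of_forall (h : IsSuccPerm π σ) {S : Setoid (Fin n)} (hS : ∀ x, S x (σ x)) : π ≤ S := by
  have key : ∀ k : ℕ, ∀ x y : Fin n, (y : ℕ) - x = k → x < y → π x y → S x y := by
    intro k
    induction k using Nat.strong_induction_on with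
    | _ k ih =>
      intro x y hk hxy hr
      obtain ⟨h1, h2⟩ := h.next x y hr hxy
      rcases h2.eq_or_lt with h2 | h2
      · rw [← h2]; exact hS x
      · exact S.trans (hS x) (ih (y - σ x) (by omega) _ _ rfl h2
          (π.trans (π.symm (h.rel x)) hr))
  intro x y hxy
  rcases lt_trichotomy x y with hlt | rfl | hlt
  · exact key _ x y rfl hlt hxy
  · exact S.refl x
  · exact S.symm (key _ y x rfl hlt (π.symm hxy))

theorem setoid_unique (h : IsSuccPerm π σ) (h' : IsSuccPerm π' σ) : π = π' :=
  le_antisymm (h.le_of_forall h'.rel) (h'.le_of_forall h.rel)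

theorem unique (h : IsSuccPerm π σ) (h' : IsSuccPerm π σ') : σ = σ' := by
  ext x
  congr 1
  by_cases hx : ∃ y, x < y ∧ π x y
  · obtain ⟨y, hxy, hr⟩ := hx
    exact le_antisymm (h.next x _ (h'.rel x) (h'.next x y hr hxy).1).2
      (h'.next x _ (h.rel x) (h.next x y hr hxy).1).2
  · have h1 : σ x ≤ x := not_lt.1 fun hlt => hx ⟨_, hlt, h.rel x⟩
    have h2 : σ' x ≤ x := not_lt.1 fun hlt => hx ⟨_, hlt, h'.rel x⟩
    exact le_antisymm (h.wrap x _ (h'.rel x) h1) (h'.wrap x _ (h.rel x) h2)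

/-- A product of `k` transpositions preserves a partition with `nonmins ≤ k`, which is coarser
than `π`. -/
theorem nonmins_le_reflLength (h : IsSuccPerm π σ) : nonmins π ≤ reflLength σ := by
  obtain ⟨w, hw, rfl, hl⟩ := exists_swap_word σ
  obtain ⟨S, -, hS, hc⟩ := exists_setoid_of_word w hw
  exact (nonmins_mono (h.le_of_forall hS)).trans (hc.trans hl.le)

end IsSuccPerm

theorem isSuccPerm_finRotate : IsSuccPerm (⊤ : Setoid (Fin n)) (finRotate n) := by
  cases n with
  | zero => exact ⟨fun x => x.elim0, fun x => x.elim0, fun x => x.elim0⟩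
  | succ n =>
    refine ⟨fun x => trivial, fun x y _ hxy => ?_, fun x y _ hx => ?_⟩
    · have hne : x ≠ Fin.last n := (lt_of_lt_of_le hxy (Fin.le_last y)).ne
      have := coe_finRotate_of_ne_last hne
      exact ⟨Fin.lt_def.2 (by omega), Fin.le_def.2 (by have := Fin.lt_def.1 hxy; omega)⟩
    · have : x = Fin.last n := by
        by_contra hne
        exact absurd ((lt_finRotate_iff_ne_last x).2 hne) (not_lt.2 hx)
      rw [this, finRotate_last]
      exact Fin.zero_le y

/-! ### Splitting a block -/

/-- The common refinement of `π` with the partition into `(i, j]` and its complement. For `π`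
noncrossing and `i < j` in one block, this splits that block and no other. -/
def split (π : Setoid (Fin n)) (i j : Fin n) : Setoid (Fin n) :=
  π ⊓ Setoid.ker fun a => i < a ∧ a ≤ j

theorem split_apply {π : Setoid (Fin n)} {i j a b : Fin n} :
    split π i j a b ↔ π a b ∧ (i < a ∧ a ≤ j ↔ i < b ∧ b ≤ j) := by
  change π a b ∧ (_ = _) ↔ _
  rw [eq_iff_iff]

theorem split_lt {π : Setoid (Fin n)} {i j : Fin n} (hij : i < j) (h : π i j) :
    split π i j < π := by
  refine lt_of_le_of_ne inf_le_left fun he => ?_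
  have h' : split π i j i j := by rw [he]; exact h
  have := (split_apply.1 h').2
  exact absurd (this.2 ⟨hij, le_rfl⟩).1 (lt_irrefl i)

theorem isNoncrossing_split {π : Setoid (Fin n)} (hπ : IsNoncrossing π) (i j : Fin n) :
    IsNoncrossing (split π i j) := by
  intro a a' b b' h1 h2 h3 hab hab'
  rw [split_apply] at *
  refine ⟨hπ a a' b b' h1 h2 h3 hab.1 hab'.1, ?_⟩
  grind

theorem IsSuccPerm.split {π : Setoid (Fin n)} {σ : Perm (Fin n)} (h : IsSuccPerm π σ)
    (hπ : IsNoncrossing π) {i j : Fin n} (hij : i < j) (hr : π i j) :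
    IsSuccPerm (split π i j) (σ * swap i j) := by
  have s := @π.symm'
  have t := @π.trans'
  have hi : (σ * swap i j) i = σ j := by simp
  have hj : (σ * swap i j) j = σ i := by simp
  have ho : ∀ x, x ≠ i → x ≠ j → (σ * swap i j) x = σ x := fun x h1 h2 => by
    simp [swap_apply_of_ne_of_ne h1 h2]
  have hni := h.next i j hr hij
  have hσj : σ j ≤ i ∨ j < σ j := by
    by_contra! hc
    exact absurd (h.wrap j i (s hr) hc.2) (not_le.2 hc.1)
  refine ⟨fun x => ?_, fun x y hxy hlt => ?_, fun x y hxy hle => ?_⟩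
  · rw [split_apply]
    by_cases hxi : x = i
    · subst hxi; rw [hi]; exact ⟨t hr (h.rel j), by grind⟩
    by_cases hxj : x = j
    · subst hxj; rw [hj]; exact ⟨t (s hr) (h.rel i), by grind⟩
    rw [ho x hxi hxj]
    refine ⟨h.rel x, ?_⟩
    have hx := h.rel x
    -- an arc joining the inside of `(i, j)` to the outside crosses the arc from `i` to `j`
    by_cases hb : π x i
    · have h1 := h.next x i hb
      have h2 := h.next x j (t hb hr)
      have h3 := h.wrap x i hb
      grind
    · have c1 := hπ i x j (σ x)
      have c2 := hπ x i (σ x) j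
      have c3 := hπ (σ x) i x j
      have c4 := hπ i (σ x) j x
      have hb1 : ¬ π (σ x) i := fun hc => hb (t hx hc)
      have hne1 : σ x ≠ i := fun hc => hb (hc ▸ hx)
      have hne2 : σ x ≠ j := fun hc => hb (t (hc ▸ hx) (s hr))
      grind
  · rw [split_apply] at hxy
    by_cases hxi : x = i
    · subst hxi; rw [hi]
      have hjy : j < y := by grind
      have := h.next j y (t (s hr) hxy.1) hjy
      exact ⟨hij.trans this.1, this.2⟩
    by_cases hxj : x = j
    · subst hxj; grind
    rw [ho x hxi hxj]
    exact h.next x y hxy.1 hlt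
  · rw [split_apply] at hxy
    by_cases hxi : x = i
    · subst hxi; rw [hi] at hle ⊢
      exact h.wrap j y (t (s hr) hxy.1) (hle.trans hij.le)
    by_cases hxj : x = j
    · subst hxj; rw [hj] at hle ⊢
      exact (h.next i y (t hr hxy.1) (by grind)).2
    rw [ho x hxi hxj] at hle ⊢
    exact h.wrap x y hxy.1 hle

/-- Every noncrossing partition with at least two blocks arises by splitting a block of a
noncrossing partition. If `y` is the least element outside the first block, its block lies between
two neighbouring elements of the first block, so that the two blocks can be merged. -/
theorem exists_eq_split {π : Setoid (Fin n)} (hπ : IsNoncrossing π) (hne : π ≠ ⊤) :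
    ∃ π' i j, IsNoncrossing π' ∧ i < j ∧ π' i j ∧ π = split π' i j := by
  classical
  have s := @π.symm'
  have t := @π.trans'
  have r := @π.refl'
  cases n with
  | zero => exact absurd (Setoid.ext fun a => a.elim0) hne
  | succ n =>
  have hex : ∃ a, ¬ π 0 a := by
    by_contra! hc
    exact hne (Setoid.ext fun a b => ⟨fun _ => trivial, fun _ => t (s (hc a)) (hc b)⟩)
  obtain ⟨y, hy, hymin⟩ : ∃ y, ¬ π 0 y ∧ ∀ z, z < y → π 0 z := by
    obtain ⟨y, hy, hmin⟩ := WellFounded.has_min wellFounded_lt {a | ¬ π 0 a} hex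
    exact ⟨y, hy, fun z hz => by_contra fun hc => hmin z hc hz⟩
  obtain ⟨M, hyM, hMy, hM⟩ := exists_ge_forall_ge π y
  have hy0 : 0 < y := Fin.pos_iff_ne_zero.2 fun hc => hy (hc ▸ r 0)
  obtain ⟨x, hxy⟩ : ∃ x : Fin (n + 1), (x : ℕ) + 1 = y :=
    ⟨⟨y - 1, by omega⟩, by have := Fin.lt_def.1 hy0; simp at this ⊢; omega⟩
  have hx_lt : ∀ z, x < z ↔ y ≤ z := fun z => by rw [Fin.lt_def, Fin.le_def]; omega
  have h0 : ∀ z : Fin (n + 1), 0 ≤ z := Fin.zero_le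
  have h0x : π 0 x := hymin x ((hx_lt y).2 le_rfl)
  have hge : ∀ z, π z y → y ≤ z := fun z hz => not_lt.1 fun hc => hy (t (hymin z hc) hz)
  -- between `y` and `M` there is no element of the first block
  have hout : ∀ z, y ≤ z → z ≤ M → ¬ π 0 z := fun z h1 h2 h3 => by
    have := hπ 0 y z M hy0
    have : y ≠ z := fun hc => hy (hc ▸ h3)
    have : z ≠ M := fun hc => hy (t h3 (hc ▸ hMy))
    grind
  -- and the other blocks meeting this interval lie inside it
  have hin : ∀ a b, π a b → y ≤ a → a ≤ M → y ≤ b ∧ b ≤ M := fun a b hab h1 h2 => by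
    by_cases hay : π a y
    · exact ⟨hge b (t (s hab) hay), hM b (t (s hab) hay)⟩
    have hb : y ≤ b := not_lt.1 fun hc => hout a h1 h2 (t (hymin b hc) (s hab))
    refine ⟨hb, not_lt.1 fun hc => ?_⟩
    have := hπ y a M b
    have : y ≠ a := fun hc => hay (hc ▸ r y)
    have : a ≠ M := fun hc => hay (hc ▸ hMy)
    grind
  refine ⟨merge π 0 y, x, M, ?_, (hx_lt M).2 hyM, ?_, ?_⟩
  · intro a a' b b' h1 h2 h3 hab hab'
    rw [merge_apply] at *
    -- the elements of the first block lie below `y` or above `M`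
    have f : ∀ z, π z 0 → z < y ∨ M < z := fun z hz => by
      by_contra! hc
      exact hout z (not_lt.1 (by grind)) (not_lt.1 (by grind)) (s hz)
    have g : ∀ z, π z y → y ≤ z ∧ z ≤ M := fun z hz => ⟨hge z hz, hM z hz⟩
    have k : ∀ z, z < y → π z 0 := fun z hz => s (hymin z hz)
    rcases hab with hab | ⟨ha | ha, hb | hb⟩ <;> rcases hab' with hab' | ⟨ha' | ha', hb' | hb'⟩
    · exact Or.inl (hπ a a' b b' h1 h2 h3 hab hab')
    · exact Or.inl (hπ a a' b b' h1 h2 h3 hab (t ha' (s hb')))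
    · exact Or.inr ⟨Or.inl (k a (by have := f a' ha'; have := g b' hb'; grind)), Or.inl ha'⟩
    · refine Or.inr ⟨?_, Or.inr ha'⟩
      have c := hπ y a a' b
      have := g a' ha'
      have := k a
      have := s ha'
      have := @s y a
      have := r y
      grind
    · exact Or.inl (hπ a a' b b' h1 h2 h3 hab (t ha' (s hb')))
    · exact Or.inl (hπ a a' b b' h1 h2 h3 (t ha (s hb)) hab')
    · exact Or.inr ⟨Or.inl ha, Or.inl ha'⟩
    · exact Or.inr ⟨Or.inl ha, Or.inl ha'⟩
    · exact Or.inr ⟨Or.inl ha, Or.inr ha'⟩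
    · exact Or.inr ⟨Or.inl ha, Or.inr ha'⟩
    · refine Or.inr ⟨Or.inl ha, ?_⟩
      have c := hπ y a' b b'
      have := g b hb
      have := k a'
      have := s hb
      have := @s y a'
      have := r y
      grind
    · exact Or.inr ⟨Or.inl ha, Or.inl ha'⟩
    · exact Or.inr ⟨Or.inl ha, Or.inl ha'⟩
    · exact Or.inr ⟨Or.inl ha, Or.inr ha'⟩
    · exact Or.inr ⟨Or.inl ha, Or.inr ha'⟩
    · refine Or.inr ⟨Or.inr ha, Or.inl ?_⟩
      have c := hπ 0 a' b b'
      have := f b hb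
      have := g a ha
      have := hin a' b' hab'
      have := s hb
      have := @s 0 a'
      have := h0 a
      grind
    · exact Or.inr ⟨Or.inr ha, Or.inl ha'⟩
    · exact Or.inr ⟨Or.inr ha, Or.inl ha'⟩
    · exact Or.inr ⟨Or.inr ha, Or.inr ha'⟩
    · exact Or.inr ⟨Or.inr ha, Or.inr ha'⟩
    · exact Or.inl (hπ a a' b b' h1 h2 h3 (t ha (s hb)) hab')
    · exact Or.inr ⟨Or.inr ha, Or.inl ha'⟩
    · exact Or.inr ⟨Or.inr ha, Or.inl ha'⟩
    · exact Or.inr ⟨Or.inr ha, Or.inr ha'⟩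
    · exact Or.inr ⟨Or.inr ha, Or.inr ha'⟩
  · exact merge_apply.2 (Or.inr ⟨Or.inl (s h0x), Or.inr hMy⟩)
  · ext a b
    rw [split_apply, merge_apply, hx_lt, hx_lt]
    constructor
    · intro hab
      exact ⟨Or.inl hab, fun hc => hin a b hab hc.1 hc.2, fun hc => hin b a (s hab) hc.1 hc.2⟩
    · rintro ⟨hab | ⟨ha | ha, hb | hb⟩, hc⟩
      · exact hab
      · exact t ha (s hb)
      · exact absurd (s ha) (hout a (hc.2 ⟨hge b hb, hM b hb⟩).1 (hc.2 ⟨hge b hb, hM b hb⟩).2)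
      · exact absurd (s hb) (hout b (hc.1 ⟨hge a ha, hM a ha⟩).1 (hc.1 ⟨hge a ha, hM a ha⟩).2)
      · exact t ha (s hb)

/-! ### The interval below the long cycle -/

/-- By induction on the number of blocks: each cut of a block multiplies the complement `σ⁻¹ c` of
`σ` in the long cycle `c` by one transposition. The second part is what puts `σ` below `c`. -/
theorem exists_isSuccPerm {π : Setoid (Fin n)} (hπ : IsNoncrossing π) :
    ∃ σ, IsSuccPerm π σ ∧ reflLength (σ⁻¹ * finRotate n) + nonmins π ≤ n - 1 := by
  induction hk : n - nonmins π using Nat.strong_induction_on generalizing π with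
  | _ k ih =>
    by_cases hne : π = ⊤
    · subst hne
      exact ⟨_, isSuccPerm_finRotate, by simpa [reflLength_one] using nonmins_le _⟩
    · obtain ⟨π', i, j, hπ', hij, hr, rfl⟩ := exists_eq_split hπ hne
      have hlt := nonmins_strictMono (split_lt hij hr)
      have hle := nonmins_le π'
      obtain ⟨σ, hσ, hl⟩ := ih (n - nonmins π') (by omega) hπ' rfl
      refine ⟨_, hσ.split hπ' hij hr, ?_⟩
      rw [mul_inv_rev, swap_inv, mul_assoc]
      have h1 := reflLength_mul_le (swap i j) (σ⁻¹ * finRotate n)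
      have h2 := reflLength_swap_le hij.ne
      omega

/-- Cutting blocks until only singletons remain writes `σ` as a product of transpositions. -/
theorem IsSuccPerm.reflLength_le {π : Setoid (Fin n)} {σ : Perm (Fin n)} (h : IsSuccPerm π σ)
    (hπ : IsNoncrossing π) : reflLength σ ≤ nonmins π := by
  induction hk : nonmins π using Nat.strong_induction_on generalizing π σ with
  | _ k ih =>
    by_cases hr : ∃ i j, i < j ∧ π i j
    · obtain ⟨i, j, hij, hr⟩ := hr
      have hlt := nonmins_strictMono (split_lt hij hr)
      have h1 := ih _ (by omega) (h.split hπ hij hr) (isNoncrossing_split hπ i j) rfl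
      have h2 := reflLength_mul_le (σ * swap i j) (swap i j)
      have h3 := reflLength_swap_le hij.ne
      rw [mul_assoc, swap_mul_self, mul_one] at h2
      omega
    · push Not at hr
      have : σ = 1 := by
        ext x
        congr 1
        rcases lt_trichotomy x (σ x) with hx | hx | hx
        · exact absurd (h.rel x) (hr _ _ hx)
        · exact hx.symm
        · exact absurd (π.symm (h.rel x)) (hr _ _ hx)
      rw [this, reflLength_one]
      exact Nat.zero_le _

theorem IsSuccPerm.reflLength_eq {π : Setoid (Fin n)} {σ : Perm (Fin n)} (h : IsSuccPerm π σ)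
    (hπ : IsNoncrossing π) : reflLength σ = nonmins π :=
  le_antisymm (h.reflLength_le hπ) h.nonmins_le_reflLength

theorem reflLength_finRotate : reflLength (finRotate n) = n - 1 := by
  rw [isSuccPerm_finRotate.reflLength_eq fun _ _ _ _ _ _ _ _ _ => trivial, nonmins_top]

theorem IsSuccPerm.absLE {π : Setoid (Fin n)} {σ : Perm (Fin n)} (h : IsSuccPerm π σ)
    (hπ : IsNoncrossing π) : AbsLE σ (finRotate n) := by
  obtain ⟨σ', h', hl⟩ := exists_isSuccPerm hπ
  obtain rfl := h.unique h'
  have h1 := h.reflLength_eq hπ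
  have h2 := reflLength_mul_le σ (σ⁻¹ * finRotate n)
  rw [mul_inv_cancel_left] at h2
  have h3 := reflLength_finRotate (n := n)
  unfold AbsLE
  omega

/-- Going down from the long cycle in the absolute order, each multiplication by a transposition
that lowers the reflection length exchanges two elements of one block, hence splits it. -/
theorem exists_isSuccPerm_of_absLE {ρ : Perm (Fin n)} (h : AbsLE ρ (finRotate n)) :
    ∃ π, IsNoncrossing π ∧ IsSuccPerm π ρ := by
  unfold AbsLE at h
  induction hk : reflLength (ρ⁻¹ * finRotate n) generalizing ρ with
  | zero =>
    obtain ⟨w, -, hp, hl⟩ := exists_swap_word (ρ⁻¹ * finRotate n)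
    rw [hk, List.length_eq_zero_iff] at hl
    rw [hl, List.prod_nil, eq_comm, inv_mul_eq_one] at hp
    exact ⟨⊤, fun _ _ _ _ _ _ _ _ _ => trivial, hp ▸ isSuccPerm_finRotate⟩
  | succ k ih =>
    obtain ⟨w, hw, hp, hl⟩ := exists_swap_word (ρ⁻¹ * finRotate n)
    obtain ⟨v, hv, hvp, hvl⟩ := exists_swap_word ρ
    rw [hk] at hl
    obtain ⟨u, w, rfl⟩ : ∃ u w', w = u :: w' := List.exists_cons_of_length_eq_add_one hl
    obtain ⟨i, j, hij, hij', rfl⟩ : ∃ i j, i ≠ j ∧ i < j ∧ u = swap i j := by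
      obtain ⟨i, j, hij, rfl⟩ := hw u List.mem_cons_self
      rcases hij.lt_or_gt with h | h
      · exact ⟨i, j, hij, h, rfl⟩
      · exact ⟨j, i, hij.symm, h, swap_comm i j⟩
    have hc : (ρ * swap i j)⁻¹ * finRotate n = w.prod := by
      rw [mul_inv_rev, mul_assoc, ← hp, List.prod_cons, swap_inv, swap_mul_self_mul]
    have h1 := reflLength_prod_le w fun s hs => hw s (List.mem_cons_of_mem _ hs)
    rw [← hc] at h1
    have h2 := reflLength_mul_le (ρ * swap i j) ((ρ * swap i j)⁻¹ * finRotate n)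
    rw [mul_inv_cancel_left] at h2
    have h3 := reflLength_mul_le ρ (swap i j)
    have h4 := reflLength_swap_le hij
    rw [List.length_cons] at hl
    obtain ⟨π, hπ, hσ⟩ := ih (ρ := ρ * swap i j) (by omega) (by omega)
    have h5 := hσ.reflLength_eq hπ
    have hvs : ∀ s ∈ v ++ [swap i j], s.IsSwap := by
      intro s hs
      rcases List.mem_append.1 hs with hs | hs
      · exact hv s hs
      · rw [List.mem_singleton.1 hs]; exact ⟨i, j, hij, rfl⟩
    obtain ⟨S, hS1, hS2, hS3⟩ := exists_setoid_of_word _ hvs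
    rw [List.prod_append, List.prod_singleton, hvp] at hS2
    rw [List.length_append, List.length_singleton] at hS3
    have hS : π = S := eq_of_le_of_nonmins_le (hσ.le_of_forall hS2) (by omega)
    have hr : π i j := by
      have := hS1 (swap i j) (by simp) i
      rwa [swap_apply_left, ← hS] at this
    refine ⟨_, isNoncrossing_split hπ i j, ?_⟩
    simpa [mul_assoc] using hσ.split hπ hij' hr

/-! ### Coxeter length and inversions -/

/-- The inversions of `σ`: pairs of positions `a < b` with `σ b < σ a`. -/
def inversions (σ : Perm (Fin n)) : Finset (Fin n × Fin n) :=
  Finset.univ.filter fun p => p.1 < p.2 ∧ σ p.2 < σ p.1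

theorem mem_inversions {σ : Perm (Fin n)} {p : Fin n × Fin n} :
    p ∈ inversions σ ↔ p.1 < p.2 ∧ σ p.2 < σ p.1 := by
  simp [inversions]

/-- The adjacent transposition `s = (i j)` preserves the order of all pairs but `(i, j)`, hence maps
the other inversions of `σ s` to inversions of `σ`. -/
theorem card_inversions_mul_swap_erase_le (σ : Perm (Fin n)) {i j : Fin n}
    (hij : (i : ℕ) + 1 = j) : ((inversions (σ * swap i j)).erase (i, j)).card ≤
      ((inversions σ).erase (i, j)).card := by
  refine Finset.card_le_card_of_injOn (fun p => (swap i j p.1, swap i j p.2)) ?_ ?_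
  · rintro ⟨a, b⟩ hp
    simp only [Finset.mem_coe, Finset.mem_erase, mem_inversions, Perm.mul_apply, ne_eq,
      Prod.mk.injEq, not_and] at hp ⊢
    obtain ⟨hne, hab, hσ⟩ := hp
    refine ⟨?_, ?_, hσ⟩
    · intro h1 h2
  
      have h1' : a = j := (swap i j).injective (by rw [h1, swap_apply_right])
      have h2' : b = i := (swap i j).injective (by rw [h2, swap_apply_left])
      subst h1' h2'
      exact absurd (Fin.lt_def.1 hab) (by omega)
    · rw [swap_apply_def, swap_apply_def]
      simp only [Fin.ext_iff, Fin.lt_def] at *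
      split_ifs <;> omega
  · rintro ⟨a, b⟩ - ⟨c, d⟩ - h
    simpa using h

theorem card_inversions_mul_swap_le (σ : Perm (Fin n)) {i j : Fin n} (hij : (i : ℕ) + 1 = j) :
    (inversions (σ * swap i j)).card ≤ (inversions σ).card + 1 := by
  have h1 := card_inversions_mul_swap_erase_le σ hij
  have h2 := Finset.pred_card_le_card_erase (s := inversions (σ * swap i j)) (a := (i, j))
  have h3 := Finset.card_erase_le (s := inversions σ) (a := (i, j))
  omega

theorem card_inversions_mul_swap_lt (σ : Perm (Fin n)) {i j : Fin n} (hij : (i : ℕ) + 1 = j)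
    (h : σ j < σ i) : (inversions (σ * swap i j)).card < (inversions σ).card := by
  have h1 := card_inversions_mul_swap_erase_le σ hij
  have h2 : (i, j) ∉ inversions (σ * swap i j) := fun hm => by
    have := (mem_inversions.1 hm).2
    simp only [Perm.mul_apply, swap_apply_left, swap_apply_right] at this
    exact lt_asymm h this
  have h3 : (i, j) ∈ inversions σ := mem_inversions.2 ⟨Fin.lt_def.2 (by simp; omega), h⟩
  rw [Finset.erase_eq_of_notMem h2] at h1
  exact lt_of_le_of_lt h1 (Finset.card_erase_lt_of_mem h3)

theorem eq_one_of_forall_lt {σ : Perm (Fin n)}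
    (h : ∀ i j : Fin n, (i : ℕ) + 1 = j → σ i < σ j) : σ = 1 := by
  have key : ∀ k : ℕ, ∀ a b : Fin n, (b : ℕ) = a + k + 1 → σ a < σ b := by
    intro k
    induction k with
    | zero => exact fun a b hb => h a b hb.symm
    | succ k ih =>
      intro a b hb
      have hc : (a : ℕ) + k + 1 < n := by have := b.2; omega
      exact (ih a ⟨_, hc⟩ rfl).trans (h ⟨_, hc⟩ b (by simp; omega))
  have hm : StrictMono σ := fun a b hab =>
    key (b - a - 1) a b (by have := Fin.lt_def.1 hab; omega)
  have hm' : StrictMono (σ⁻¹ : Perm (Fin n)) := fun a b hab => hm.lt_iff_lt.1 (by simpa using hab)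
  ext x
  congr 1
  refine le_antisymm ?_ (hm.le_apply)
  simpa using hm.monotone (hm'.le_apply (x := x))

/-- Bubble sort: multiplication by an adjacent transposition at a descent removes an inversion. -/
theorem exists_adjacent_word (σ : Perm (Fin n)) : ∃ w : List (Perm (Fin n)),
    (∀ s ∈ w, ∃ i j : Fin n, (i : ℕ) + 1 = j ∧ s = swap i j) ∧ w.prod = σ ∧
      w.length ≤ (inversions σ).card := by
  induction hk : (inversions σ).card using Nat.strong_induction_on generalizing σ with
  | _ k ih =>
    by_cases h : ∃ i j : Fin n, (i : ℕ) + 1 = j ∧ σ j < σ i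
    · obtain ⟨i, j, hij, hlt⟩ := h
      have hc := card_inversions_mul_swap_lt σ hij hlt
      obtain ⟨w, hw, hp, hl⟩ := ih _ (hk ▸ hc) _ rfl
      refine ⟨w ++ [swap i j], fun s hs => ?_, ?_, ?_⟩
      · rcases List.mem_append.1 hs with hs | hs
        · exact hw s hs
        · exact ⟨i, j, hij, List.mem_singleton.1 hs⟩
      · rw [List.prod_append, hp, List.prod_singleton, mul_assoc, swap_mul_self, mul_one]
      · rw [List.length_append, List.length_singleton]; omega
    · push Not at h
      refine ⟨[], by simp, ?_, Nat.zero_le _⟩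
      refine (eq_one_of_forall_lt fun i j hij => lt_of_le_of_ne (h i j hij) fun hc => ?_).symm
      have := σ.injective hc
      subst this
      omega

theorem length_eq_card_inversions (σ : Perm (Fin n)) : length σ = (inversions σ).card := by
  obtain ⟨w, hw, hp, hl⟩ := exists_adjacent_word σ
  refine le_antisymm ?_ ?_
  · rw [← hp] at hl ⊢
    exact (wordLength_le w hw).trans hl
  · obtain ⟨v, hv, hvp, hvl⟩ := exists_word
      (S := {s | ∃ i j : Fin n, (i : ℕ) + 1 = j ∧ s = swap i j}) ⟨w, hw, hp⟩
    have key : ∀ (v : List (Perm (Fin n)))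
        (_ : ∀ s ∈ v, ∃ i j : Fin n, (i : ℕ) + 1 = j ∧ s = swap i j) (τ : Perm (Fin n)),
        (inversions (τ * v.prod)).card ≤ (inversions τ).card + v.length := by
      intro v
      induction v with
      | nil => simp
      | cons s v ih =>
        intro hv τ
        obtain ⟨i, j, hij, rfl⟩ := hv s List.mem_cons_self
        have h1 := ih (fun s hs => hv s (List.mem_cons_of_mem _ hs)) (τ * swap i j)
        have h2 := card_inversions_mul_swap_le τ hij
        rw [List.prod_cons, ← mul_assoc, List.length_cons]
        omega
    have h1 := key v hv 1
    have h2 : (inversions (1 : Perm (Fin n))).card = 0 := by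
      refine Finset.card_eq_zero.2 (Finset.filter_eq_empty_iff.2 ?_)
      rintro p - ⟨h1, h2⟩
      exact lt_asymm h1 h2
    rw [one_mul, hvp, h2, zero_add, hvl] at h1
    exact h1

/-! ### Arcs of a permutation -/

/-- The points `a` whose arc from `a` to `σ a` goes up and passes strictly over `k`. -/
def arcsOver (σ : Perm (Fin n)) (k : ℕ) : Finset (Fin n) :=
  Finset.univ.filter fun a => (a : ℕ) < k ∧ k < σ a

/-- The points `a` whose arc from `a` to `σ a` goes up and passes over the gap from `k - 1` to
`k`. -/
def arcsOverGap (σ : Perm (Fin n)) (k : ℕ) : Finset (Fin n) :=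
  Finset.univ.filter fun a => (a : ℕ) < k ∧ k ≤ σ a

theorem mem_arcsOver {σ : Perm (Fin n)} {k : ℕ} {a : Fin n} :
    a ∈ arcsOver σ k ↔ (a : ℕ) < k ∧ k < σ a := by simp [arcsOver]

theorem mem_arcsOverGap {σ : Perm (Fin n)} {k : ℕ} {a : Fin n} :
    a ∈ arcsOverGap σ k ↔ (a : ℕ) < k ∧ k ≤ σ a := by simp [arcsOverGap]

theorem card_arcsOverGap (σ : Perm (Fin n)) (b : Fin n) :
    (arcsOverGap σ b).card = (arcsOver σ b).card + if σ.symm b < b then 1 else 0 := by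
  classical
  split_ifs with h
  · rw [← Finset.card_insert_of_notMem (s := arcsOver σ b) (a := σ.symm b)
      (by simp [mem_arcsOver])]
    congr 1
    ext a
    simp only [Finset.mem_insert, mem_arcsOverGap, mem_arcsOver, Equiv.eq_symm_apply]
    constructor
    · rintro ⟨h1, h2⟩
      rcases h2.eq_or_lt with h2 | h2
      · exact Or.inl (Fin.ext h2.symm)
      · exact Or.inr ⟨h1, h2⟩
    · rintro (h1 | ⟨h1, h2⟩)
      · rw [← h1, Equiv.symm_apply_apply] at h
        exact ⟨by rw [← h1]; exact h, by rw [h1]⟩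
      · exact ⟨h1, h2.le⟩
  · rw [add_zero]
    congr 1
    ext a
    rw [mem_arcsOverGap, mem_arcsOver]
    refine ⟨fun ⟨h1, h2⟩ => ⟨h1, lt_of_le_of_ne h2 fun hc => h ?_⟩, fun ⟨h1, h2⟩ => ⟨h1, h2.le⟩⟩
    rw [Fin.ext hc, Equiv.symm_apply_apply, ← Fin.ext hc]
    exact h1

theorem card_arcsOverGap_succ (σ : Perm (Fin n)) (b : Fin n) :
    (arcsOverGap σ (b + 1)).card = (arcsOver σ b).card + if b < σ b then 1 else 0 := by
  classical
  split_ifs with h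
  · rw [← Finset.card_insert_of_notMem (s := arcsOver σ b) (a := b) (by simp [mem_arcsOver])]
    congr 1
    ext a
    simp only [Finset.mem_insert, mem_arcsOverGap, mem_arcsOver]
    constructor
    · rintro ⟨h1, h2⟩
      by_cases hab : a = b
      · exact Or.inl hab
      · exact Or.inr ⟨by omega, by omega⟩
    · rintro (rfl | ⟨h1, h2⟩)
      · exact ⟨by omega, h⟩
      · exact ⟨by omega, h2⟩
  · rw [add_zero]
    congr 1
    ext a
    rw [mem_arcsOverGap, mem_arcsOver]
    refine ⟨fun ⟨h1, h2⟩ => ⟨?_, h2⟩, fun ⟨h1, h2⟩ => ⟨by omega, h2⟩⟩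
    refine lt_of_le_of_ne (by omega) fun hc => h ?_
    rw [← Fin.ext hc]
    exact Fin.lt_def.2 (by omega)

theorem arcsOverGap_zero (σ : Perm (Fin n)) : arcsOverGap σ 0 = ∅ := by
  ext a; simp [mem_arcsOverGap]

theorem arcsOverGap_self (σ : Perm (Fin n)) : arcsOverGap σ n = ∅ := by
  ext a
  simp only [mem_arcsOverGap, Finset.notMem_empty, iff_false]
  have := (σ a).2
  omega

theorem sum_card_arcsOverGap (σ : Perm (Fin n)) :
    ∑ k ∈ Finset.range (n + 1), (arcsOverGap σ k).card = ∑ a, ((σ a : ℕ) - a) := by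
  simp only [arcsOverGap, Finset.card_filter]
  rw [Finset.sum_comm]
  refine Finset.sum_congr rfl fun a _ => ?_
  rw [← Finset.card_filter]
  have : (Finset.range (n + 1)).filter (fun k => (a : ℕ) < k ∧ k ≤ σ a) =
      Finset.Ioc (a : ℕ) (σ a) := by
    ext k
    have := (σ a).2
    simp only [Finset.mem_filter, Finset.mem_range, Finset.mem_Ioc]
    omega
  rw [this, Nat.card_Ioc]

/-- Both sums equal half of `∑ |σ a - a|`, since `∑ σ a = ∑ a`. -/
theorem sum_tsub_comm (σ : Perm (Fin n)) :
    ∑ a, ((σ a : ℕ) - a) = ∑ a : Fin n, ((a : ℕ) - σ a) := by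
  have h1 : ∑ a, (σ a : ℕ) = ∑ a : Fin n, (a : ℕ) := Equiv.sum_comp σ fun a => (a : ℕ)
  have h2 : ∑ a, (((σ a : ℕ) - a) + a) = ∑ a : Fin n, (((a : ℕ) - σ a) + σ a) :=
    Finset.sum_congr rfl fun a _ => by omega
  rw [Finset.sum_add_distrib, Finset.sum_add_distrib, h1] at h2
  exact Nat.add_right_cancel h2

theorem card_filter_and_add {α : Type*} [Fintype α] (p r s : α → Prop)
    [DecidablePred p] [DecidablePred r] [DecidablePred s] (h : ∀ a, p a → (s a ↔ ¬ r a)) :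
    (Finset.univ.filter fun a => p a ∧ r a).card + (Finset.univ.filter fun a => p a ∧ s a).card =
      (Finset.univ.filter p).card := by
  classical
  rw [← Finset.card_union_of_disjoint]
  · congr 1
    ext a
    have := h a
    simp only [Finset.mem_union, Finset.mem_filter, Finset.mem_univ, true_and]
    tauto
  · refine Finset.disjoint_left.2 fun a ha hb => ?_
    simp only [Finset.mem_filter, Finset.mem_univ, true_and] at ha hb
    exact (h a ha.1).1 hb.2 ha.2

theorem card_filter_perm {p : Fin n → Prop} [DecidablePred p] (σ : Perm (Fin n)) :
    (Finset.univ.filter fun a => p (σ a)).card = (Finset.univ.filter p).card :=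
  Finset.card_equiv σ (by simp)

namespace IsSuccPerm

variable {π : Setoid (Fin n)} {σ : Perm (Fin n)}

theorem not_rel_of_lt (h : IsSuccPerm π σ) {a b : Fin n} (h1 : a < b) (h2 : b < σ a) : ¬ π a b :=
  fun hc => absurd (h.next a b hc h1).2 (not_le.2 h2)

theorem apply_lt_apply (h : IsSuccPerm π σ) (hπ : IsNoncrossing π) {a b : Fin n} (h1 : a < b)
    (h2 : b < σ a) : σ b < σ a := by
  by_contra! hc
  rcases hc.eq_or_lt with hc | hc
  · exact h1.ne (σ.injective hc)
  · exact h.not_rel_of_lt h1 h2 (hπ a b (σ a) (σ b) h1 h2 hc (h.rel a) (h.rel b))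

theorem apply_lt_apply_of_le (h : IsSuccPerm π σ) (hπ : IsNoncrossing π) {a b : Fin n}
    (h1 : b < a) (h2 : σ b ≤ b) (h3 : σ a ≤ b) : σ a < σ b := by
  have hab : ¬ π b a := fun hc => absurd (h.next b a hc h1).1 (not_lt.2 h2)
  by_contra! hc
  rcases hc.eq_or_lt with hc | hc
  · exact h1.ne (σ.injective hc)
  rcases h3.eq_or_lt with h3 | h3
  · exact hab (π.symm (h3 ▸ h.rel a))
  · exact hab (π.trans (h.rel b) (π.trans (hπ _ _ _ _ hc h3 h1 (π.symm (h.rel b))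
      (π.symm (h.rel a))) (π.symm (h.rel a))))

/-- If `b` is not the maximum of its block, the points `a < b` in inversion with `b` are those with
an arc over `b`. If `b` is the maximum, `σ b` is the minimum of the block, and counting the values
below `σ b` and up to `b` gives the correction `b - σ b`. The subtraction is truncated, so that this
term vanishes in the first case. -/
theorem card_inversions_right (h : IsSuccPerm π σ) (hπ : IsNoncrossing π) (b : Fin n) :
    (Finset.univ.filter fun a => a < b ∧ σ b < σ a).card =
      (arcsOver σ b).card + ((b : ℕ) - σ b) := by
  rcases lt_or_ge b (σ b) with hb | hb
  · have : (b : ℕ) - σ b = 0 := Nat.sub_eq_zero_of_le (Fin.le_def.1 hb.le)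
    rw [this, add_zero]
    congr 1
    ext a
    simp only [Finset.mem_filter, Finset.mem_univ, true_and, mem_arcsOver, Fin.val_fin_lt]
    exact ⟨fun ⟨h1, h2⟩ => ⟨h1, hb.trans h2⟩, fun ⟨h1, h2⟩ => ⟨h1, h.apply_lt_apply hπ h1 h2⟩⟩
  · have hinj : ∀ a, σ a = σ b → a = b := fun a hc => σ.injective hc
    have e1 := card_filter_and_add (fun a => a < b) (fun a => σ b < σ a) (fun a => σ a < σ b)
      (fun a ha => by have := hinj a; grind)
    have e2 := card_filter_and_add (fun a => σ a < σ b) (fun a => a < b) (fun a => b < a)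
      (fun a ha => by have := hinj a; grind)
    have e3 := card_filter_and_add (fun a => σ a ≤ b) (fun a => a ≤ b) (fun a => b < a)
      (fun a ha => by grind)
    have e4 := card_filter_and_add (fun a => a ≤ b) (fun a => σ a ≤ b) (fun a => b < σ a)
      (fun a ha => by grind)
    have c1 : (Finset.univ.filter fun a => σ a < σ b).card = (σ b : ℕ) := by
      rw [card_filter_perm (p := fun a => a < σ b), Finset.filter_gt_eq_Iio, Fin.card_Iio]
    have c2 : (Finset.univ.filter fun a => σ a ≤ b).card = (b : ℕ) + 1 := by
      rw [card_filter_perm (p := fun a => a ≤ b), Finset.filter_ge_eq_Iic, Fin.card_Iic]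
    have c3 : (Finset.univ.filter fun a => a < b).card = (b : ℕ) := by
      rw [Finset.filter_gt_eq_Iio, Fin.card_Iio]
    have c4 : (Finset.univ.filter fun a => a ≤ b).card = (b : ℕ) + 1 := by
      rw [Finset.filter_ge_eq_Iic, Fin.card_Iic]
    have f1 : (Finset.univ.filter fun a => a < b ∧ σ a < σ b) =
        Finset.univ.filter fun a => σ a < σ b ∧ a < b :=
      Finset.filter_congr fun a _ => and_comm
    have f2 : (Finset.univ.filter fun a => σ a < σ b ∧ b < a) =
        Finset.univ.filter fun a => σ a ≤ b ∧ b < a :=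
      Finset.filter_congr fun a _ => ⟨fun ⟨h1, h2⟩ => ⟨(h1.trans_le hb).le, h2⟩,
        fun ⟨h1, h2⟩ => ⟨h.apply_lt_apply_of_le hπ h2 hb h1, h2⟩⟩
    have f3 : (Finset.univ.filter fun a => σ a ≤ b ∧ a ≤ b) =
        Finset.univ.filter fun a => a ≤ b ∧ σ a ≤ b :=
      Finset.filter_congr fun a _ => and_comm
    have f4 : (Finset.univ.filter fun a => a ≤ b ∧ b < σ a) = arcsOver σ b := by
      refine Finset.filter_congr fun a _ => ?_
      refine ⟨fun ⟨h1, h2⟩ => ⟨lt_of_le_of_ne h1 fun hc => ?_, h2⟩, fun ⟨h1, h2⟩ => ⟨h1.le, h2⟩⟩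
      rw [Fin.ext hc] at h2
      exact absurd hb (not_le.2 h2)
    rw [c3, f1] at e1
    rw [c1, f2] at e2
    rw [c2, f3] at e3
    rw [c4, f4] at e4
    have := Fin.le_def.1 hb
    omega

theorem length_eq (h : IsSuccPerm π σ) (hπ : IsNoncrossing π) :
    length σ = ∑ b : Fin n, (arcsOver σ b).card +
      ∑ k ∈ Finset.range (n + 1), (arcsOverGap σ k).card := by
  rw [length_eq_card_inversions, sum_card_arcsOverGap, sum_tsub_comm, ← Finset.sum_add_distrib,
    inversions, Finset.card_filter, ← Finset.univ_product_univ, Finset.sum_product_right]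
  refine Finset.sum_congr rfl fun b _ => ?_
  rw [← h.card_inversions_right hπ, Finset.card_filter]

end IsSuccPerm

namespace DyckPath

/-! ### Heights of a Dyck path -/

theorem toList_length (p : DyckPath n) : p.1.toList.length = 2 * n := by
  rw [← DyckWord.two_mul_semilength_eq_length, p.2]

theorem height_zero (p : DyckPath n) : p.height 0 = 0 := by simp [height]

theorem height_nonneg (p : DyckPath n) (x : ℕ) : 0 ≤ p.height x := by
  have := p.1.count_D_le_count_U x
  unfold height
  omega

theorem height_end (p : DyckPath n) : p.height (2 * n) = 0 := by
  have := p.1.count_U_eq_count_D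
  rw [height, List.take_of_length_le p.toList_length.le, this, sub_self]

theorem height_le (p : DyckPath n) (x : ℕ) : p.height x ≤ n := by
  have h1 : (p.1.toList.take x).count DyckStep.U ≤ p.1.toList.count DyckStep.U :=
    (List.take_sublist x _).count_le _
  have h2 : p.1.toList.count DyckStep.U = n := p.2
  unfold height
  omega

theorem height_succ (p : DyckPath n) {x : ℕ} (hx : x < 2 * n) :
    p.height (x + 1) = p.height x +
      if p.1.toList[x]'(by rw [p.toList_length]; exact hx) = DyckStep.U then 1 else -1 := by
  have hx' : x < p.1.toList.length := by rw [p.toList_length]; exact hx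
  unfold height
  rw [← List.take_append_getElem hx', List.count_append, List.count_append]
  rcases DyckStep.dichotomy (p.1.toList[x]) with h | h <;> simp [h] <;> ring

theorem height_succ_or (p : DyckPath n) {x : ℕ} (hx : x < 2 * n) :
    p.height (x + 1) = p.height x + 1 ∨ p.height (x + 1) = p.height x - 1 := by
  rw [p.height_succ hx]
  split_ifs
  · exact Or.inl rfl
  · exact Or.inr rfl

theorem height_emod_two (p : DyckPath n) {x : ℕ} (hx : x ≤ 2 * n) :
    p.height x % 2 = (x : ℤ) % 2 := by
  induction x with
  | zero => simp [height_zero]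
  | succ x ih =>
    have := ih (by omega)
    rcases p.height_succ_or (x := x) (by omega) with h | h <;> rw [h] <;> push_cast <;> omega

theorem ext_of_height {p p' : DyckPath n} (h : ∀ x ≤ 2 * n, p.height x = p'.height x) :
    p = p' := by
  refine Subtype.ext (DyckWord.ext (List.ext_getElem ?_ fun x h1 h2 => ?_))
  · rw [p.toList_length, p'.toList_length]
  · have hx : x < 2 * n := p.toList_length ▸ h1
    have h3 := p.height_succ hx
    have h4 := p'.height_succ hx
    rw [h _ hx, h _ hx.le, h4] at h3
    rcases DyckStep.dichotomy (p.1.toList[x]) with h5 | h5 <;>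
      rcases DyckStep.dichotomy (p'.1.toList[x]) with h6 | h6 <;>
        simp_all

/-- A down step ending at a labelled vertex: by discrete continuity, the last earlier point at the
height of that vertex is a labelled vertex of the same block. -/
theorem exists_sees_left (p : DyckPath n) (i : Fin n)
    (h : p.height (2 * i + 1) = p.height (2 * i) - 1) : ∃ j, j < i ∧ p.Sees j i := by
  classical
  have hi := i.2
  have hpos := p.height_nonneg (2 * i + 1)
  have hpar := p.height_emod_two (x := 2 * i + 1) (by omega)
  set x := Nat.findGreatest (fun x => p.height x ≤ p.height (2 * i + 1)) (2 * i) with hx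
  have h1 : p.height x ≤ p.height (2 * i + 1) :=
    Nat.findGreatest_spec (P := fun x => p.height x ≤ p.height (2 * i + 1)) (Nat.zero_le _)
      (by rw [p.height_zero]; exact hpos)
  have h2 : x ≤ 2 * i := Nat.findGreatest_le _
  have h3 : ∀ y, x < y → y ≤ 2 * i → p.height (2 * i + 1) < p.height y := fun y hy hy' =>
    not_le.1 (Nat.findGreatest_is_greatest hy hy')
  have h4 : x < 2 * i := lt_of_le_of_ne h2 fun hc => by rw [hc] at h1; omega
  have h5 := h3 (x + 1) (by omega) (by omega)
  have h6 : p.height x = p.height (2 * i + 1) := by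
    rcases p.height_succ_or (x := x) (by omega) with h | h <;> omega
  have h7 := p.height_emod_two (x := x) (by omega)
  push_cast at hpar
  refine ⟨⟨x / 2, by omega⟩, Fin.lt_def.2 (by simp; omega), ?_⟩
  have hxe : 2 * (x / 2) + 1 = x := by omega
  refine ⟨by simp [hxe, h6], fun y hy1 hy2 => ?_⟩
  simp only [hxe] at hy1 hy2 ⊢
  rw [h6]
  rcases lt_trichotomy y (2 * i + 1) with hy | rfl | hy
  · rcases (show x ≤ y by omega).eq_or_lt with rfl | hy'
    · exact h6.ge
    · exact (h3 y hy' (by omega)).le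
  · exact le_rfl
  · omega

/-- An up step starting at a labelled vertex: by discrete continuity, the first later point at the
height of that vertex is a labelled vertex of the same block. -/
theorem exists_sees_right (p : DyckPath n) (i : Fin n)
    (h : p.height (2 * i + 2) = p.height (2 * i + 1) + 1) : ∃ j, i < j ∧ p.Sees i j := by
  classical
  have hi := i.2
  have hpos := p.height_nonneg (2 * i + 1)
  have hpar := p.height_emod_two (x := 2 * i + 1) (by omega)
  push_cast at hpar
  have hex : ∃ x, 2 * (i : ℕ) + 2 ≤ x ∧ p.height x ≤ p.height (2 * i + 1) :=
    ⟨2 * n, by omega, by rw [p.height_end]; exact hpos⟩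
  set x := Nat.find hex with hx
  obtain ⟨h1, h2⟩ : 2 * (i : ℕ) + 2 ≤ x ∧ p.height x ≤ p.height (2 * i + 1) := Nat.find_spec hex
  have hxn : x ≤ 2 * n := Nat.find_min' hex ⟨by omega, by rw [p.height_end]; exact hpos⟩
  have h3 : ∀ y, 2 * (i : ℕ) + 2 ≤ y → y < x → p.height (2 * i + 1) < p.height y :=
    fun y hy hy' => not_le.1 fun hc => Nat.find_min hex hy' ⟨hy, hc⟩
  have h4 : 2 * (i : ℕ) + 2 < x := lt_of_le_of_ne h1 fun hc => by rw [← hc] at h2; omega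
  obtain ⟨z, hz⟩ : ∃ z, x = z + 1 := ⟨x - 1, by omega⟩
  have h5 := h3 z (by omega) (by omega)
  have h6 : p.height x = p.height (2 * i + 1) := by
    rcases p.height_succ_or (x := z) (by omega) with h | h <;> rw [← hz] at h <;> omega
  have h7 := p.height_emod_two (x := x) (by omega)
  have hx2 : x ≠ 2 * n := fun hc => by rw [hc, p.height_end] at h6; omega
  refine ⟨⟨x / 2, by omega⟩, Fin.lt_def.2 (by simp; omega), ?_⟩
  have hxe : 2 * (x / 2) + 1 = x := by omega
  refine ⟨by simp [hxe, h6], fun y hy1 hy2 => ?_⟩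
  simp only [hxe] at hy1 hy2
  rcases lt_trichotomy y (2 * i + 1) with hy | rfl | hy
  · omega
  · exact le_rfl
  · rcases (show y ≤ x by omega).eq_or_lt with rfl | hy'
    · exact h6.ge
    · exact (h3 y (by omega) hy').le

theorem down_iff (p : DyckPath n) (i : Fin n) :
    p.height (2 * i + 1) = p.height (2 * i) - 1 ↔ ∃ j, j < i ∧ p.Sees j i := by
  refine ⟨p.exists_sees_left i, fun ⟨j, hj, hs⟩ => ?_⟩
  have hj' := Fin.lt_def.1 hj
  have h1 := hs.2 (2 * i) (by omega) (by omega)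
  rw [hs.1] at h1
  rcases p.height_succ_or (x := 2 * i) (by omega) with h | h <;> omega

theorem up_iff (p : DyckPath n) (i : Fin n) :
    p.height (2 * i + 2) = p.height (2 * i + 1) + 1 ↔ ∃ j, i < j ∧ p.Sees i j := by
  refine ⟨p.exists_sees_right i, fun ⟨j, hj, hs⟩ => ?_⟩
  have hj' := Fin.lt_def.1 hj
  have hj2 := j.2
  have h1 := hs.2 (2 * i + 2) (by omega) (by omega)
  have h2 : p.height (2 * i + 2) = _ ∨ p.height (2 * i + 2) = _ :=
    p.height_succ_or (x := 2 * i + 1) (by omega)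
  omega

/-- The steps of a path can be read off from the minima and maxima of the blocks of `phi p`. -/
theorem phi_injective : Function.Injective (phi (n := n)) := by
  intro p p' h
  have hs : ∀ i j, p.Sees i j ↔ p'.Sees i j := fun i j => by
    have : p.partition = p'.partition := congrArg Subtype.val h
    change p.partition i j ↔ p'.partition i j
    rw [this]
  refine ext_of_height fun x => ?_
  induction x with
  | zero => intro _; rw [height_zero, height_zero]
  | succ x ih =>
    intro hx
    have ih := ih (by omega)
    have h1 := p.height_succ_or (x := x) (by omega)
    have h2 := p'.height_succ_or (x := x) (by omega)
    rcases Nat.even_or_odd' x with ⟨k, rfl | rfl⟩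
    · obtain ⟨b, rfl⟩ : ∃ b : Fin n, (b : ℕ) = k := ⟨⟨k, by omega⟩, rfl⟩
      have h3 := p.down_iff b
      simp only [hs] at h3
      rw [← p'.down_iff b] at h3
      clear hs h
      omega
    · obtain ⟨b, rfl⟩ : ∃ b : Fin n, (b : ℕ) = k := ⟨⟨k, by omega⟩, rfl⟩
      have h3 := p.up_iff b
      simp only [hs] at h3
      rw [← p'.up_iff b] at h3
      clear hs h
      rw [add_assoc, one_add_one_eq_two] at h1 h2 ⊢
      omega

/-! ### Area -/

/-- The number of lattice points at a given abscissa below a vertex of height `m`, as the abscissa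
has the parity of `m`. -/
theorem card_filter_even_add (m : ℕ) :
    ((Finset.range m).filter fun y => Even (m + y)).card = m / 2 := by
  induction m using Nat.twoStepInduction with
  | zero => rfl
  | one => rfl
  | more m ih _ =>
    have h : ((Finset.range m).filter fun y => Even (m + 2 + y)) =
        (Finset.range m).filter fun y => Even (m + y) :=
      Finset.filter_congr fun y _ => by simp only [Nat.even_add]; simp
    rw [Finset.range_add_one, Finset.filter_insert, if_neg (by rw [Nat.even_iff]; omega),
      Finset.range_add_one, Finset.filter_insert, if_pos (by rw [Nat.even_iff]; omega), h,
      Finset.card_insert_of_notMem (by simp), ih]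
    omega

theorem area_eq_sum (p : DyckPath n) :
    p.area = ∑ x ∈ Finset.range (2 * n + 1), (p.height x).toNat / 2 := by
  rw [area, Finset.card_filter, Finset.sum_product]
  refine Finset.sum_congr rfl fun x hx => ?_
  have h1 := p.height_nonneg x
  have h2 := p.height_le x
  have h3 := p.height_emod_two (x := x) (by rw [Finset.mem_range] at hx; omega)
  rw [← Finset.card_filter, ← card_filter_even_add]
  congr 1
  ext y
  simp only [Finset.mem_filter, Finset.mem_range, Nat.even_iff]
  omega

/-! ### The path of a permutation -/

theorem sum_range_two_mul_add_one (f : ℕ → ℕ) (n : ℕ) :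
    ∑ x ∈ Finset.range (2 * n + 1), f x =
      ∑ k ∈ Finset.range n, f (2 * k + 1) + ∑ k ∈ Finset.range (n + 1), f (2 * k) := by
  induction n with
  | zero => simp
  | succ n ih =>
    rw [show 2 * (n + 1) + 1 = 2 * n + 1 + 1 + 1 by ring, Finset.sum_range_succ,
      Finset.sum_range_succ, ih, Finset.sum_range_succ (fun k => f (2 * k + 1)) n,
      Finset.sum_range_succ (fun k => f (2 * k)) (n + 1), show 2 * (n + 1) = 2 * n + 1 + 1 by ring]
    have h : f (2 * n + 2) = f (2 * n + 1 + 1) := rfl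
    omega

open Classical in
/-- The steps of the path attached to `σ`. The vertex labelled `i` is entered by an up step unless
`i` is the end of an ascending arc of `σ`, and left by an up step iff it is the start of one. -/
noncomputable def stepOf (σ : Perm (Fin n)) (x : ℕ) : DyckStep :=
  if ∃ i : Fin n, x = 2 * i ∧ ¬ σ.symm i < i ∨ x = 2 * i + 1 ∧ i < σ i then DyckStep.U
    else DyckStep.D

/-- The height reached after `x` of the steps `stepOf σ`. -/
def heightOf (σ : Perm (Fin n)) (x : ℕ) : ℕ :=
  if x % 2 = 0 then 2 * (arcsOverGap σ (x / 2)).card else 2 * (arcsOver σ (x / 2)).card + 1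

theorem heightOf_succ (σ : Perm (Fin n)) {x : ℕ} (hx : x < 2 * n) :
    (heightOf σ (x + 1) : ℤ) = heightOf σ x + if stepOf σ x = DyckStep.U then 1 else -1 := by
  classical
  rcases Nat.even_or_odd' x with ⟨k, rfl | rfl⟩
  · obtain ⟨b, rfl⟩ : ∃ b : Fin n, (b : ℕ) = k := ⟨⟨k, by omega⟩, rfl⟩
    have h := card_arcsOverGap σ b
    have hs : stepOf σ (2 * b) = DyckStep.U ↔ ¬ σ.symm b < b := by
      unfold stepOf
      split_ifs with hc
      · obtain ⟨i, ⟨h1, h2⟩ | ⟨h1, h2⟩⟩ := hc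
        · obtain rfl : i = b := Fin.ext (by omega)
          simpa using h2
        · omega
      · simp only [false_iff]
        exact fun h => hc ⟨b, Or.inl ⟨rfl, h⟩⟩
    have e1 : (2 * (b : ℕ) + 1) % 2 = 1 := by omega
    have e2 : (2 * (b : ℕ) + 1) / 2 = b := by omega
    have e3 : 2 * (b : ℕ) / 2 = b := by omega
    simp only [hs, heightOf, e1, e2, e3, Nat.mul_mod_right, if_true, one_ne_zero, if_false, h]
    split_ifs <;> push_cast <;> omega
  · obtain ⟨b, rfl⟩ : ∃ b : Fin n, (b : ℕ) = k := ⟨⟨k, by omega⟩, rfl⟩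
    have h := card_arcsOverGap_succ σ b
    have hs : stepOf σ (2 * b + 1) = DyckStep.U ↔ b < σ b := by
      unfold stepOf
      split_ifs with hc
      · obtain ⟨i, ⟨h1, h2⟩ | ⟨h1, h2⟩⟩ := hc
        · omega
        · obtain rfl : i = b := Fin.ext (by omega)
          simpa using h2
      · simp only [false_iff]
        exact fun h => hc ⟨b, Or.inr ⟨rfl, h⟩⟩
    have e1 : (2 * (b : ℕ) + 1) % 2 = 1 := by omega
    have e2 : (2 * (b : ℕ) + 1) / 2 = b := by omega
    have e3 : (2 * (b : ℕ) + 1 + 1) / 2 = b + 1 := by omega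
    have e4 : (2 * (b : ℕ) + 1 + 1) % 2 = 0 := by omega
    simp only [hs, heightOf, e1, e2, e3, e4, if_true, one_ne_zero, if_false, h]
    split_ifs <;> push_cast <;> omega

theorem count_stepOf (σ : Perm (Fin n)) {x : ℕ} (hx : x ≤ 2 * n) :
    ((((List.range x).map (stepOf σ)).count DyckStep.U : ℕ) : ℤ) -
      (((List.range x).map (stepOf σ)).count DyckStep.D : ℕ) = heightOf σ x := by
  induction x with
  | zero => simp [heightOf, arcsOverGap_zero]
  | succ x ih =>
    rw [heightOf_succ σ (by omega), ← ih (by omega), List.range_succ, List.map_append,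
      List.count_append, List.count_append]
    rcases DyckStep.dichotomy (stepOf σ x) with h | h <;> simp [h] <;> ring

theorem heightOf_end (σ : Perm (Fin n)) : heightOf σ (2 * n) = 0 := by
  simp [heightOf, arcsOverGap_self]

theorem take_steps (σ : Perm (Fin n)) (x : ℕ) :
    ((List.range (2 * n)).map (stepOf σ)).take x =
      (List.range (min x (2 * n))).map (stepOf σ) := by
  rw [← List.map_take, List.take_range]

/-- The Dyck word with steps `stepOf σ`. -/
noncomputable def wordOf (σ : Perm (Fin n)) : DyckWord where
  toList := (List.range (2 * n)).map (stepOf σ)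
  count_U_eq_count_D := by
    have := count_stepOf σ le_rfl
    rw [heightOf_end] at this
    omega
  count_D_le_count_U x := by
    rw [take_steps]
    have := count_stepOf σ (min_le_right x (2 * n))
    omega

/-- The Dyck path with steps `stepOf σ`. -/
noncomputable def ofPerm (σ : Perm (Fin n)) : DyckPath n :=
  ⟨wordOf σ, by
    have h := (wordOf σ).two_mul_semilength_eq_length
    simp only [wordOf, List.length_map, List.length_range] at h
    exact Nat.eq_of_mul_eq_mul_left two_pos h⟩

theorem height_ofPerm (σ : Perm (Fin n)) {x : ℕ} (hx : x ≤ 2 * n) :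
    (ofPerm σ).height x = heightOf σ x := by
  have : (ofPerm σ).1.toList = (List.range (2 * n)).map (stepOf σ) := rfl
  rw [height, this, take_steps, min_eq_left hx, count_stepOf σ hx]

theorem height_ofPerm_even (σ : Perm (Fin n)) {k : ℕ} (hk : k ≤ n) :
    (ofPerm σ).height (2 * k) = 2 * (arcsOverGap σ k).card := by
  rw [height_ofPerm σ (by omega)]
  simp [heightOf]

theorem height_ofPerm_odd (σ : Perm (Fin n)) {k : ℕ} (hk : k < n) :
    (ofPerm σ).height (2 * k + 1) = 2 * (arcsOver σ k).card + 1 := by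
  rw [height_ofPerm σ (by omega)]
  have e1 : (2 * k + 1) % 2 = 1 := by omega
  have e2 : (2 * k + 1) / 2 = k := by omega
  simp [heightOf, e1, e2]

theorem area_ofPerm (σ : Perm (Fin n)) : (ofPerm σ).area =
    ∑ b : Fin n, (arcsOver σ b).card + ∑ k ∈ Finset.range (n + 1), (arcsOverGap σ k).card := by
  rw [area_eq_sum, sum_range_two_mul_add_one,
    Fin.sum_univ_eq_sum_range (fun b => (arcsOver σ b).card)]
  congr 1
  · refine Finset.sum_congr rfl fun k hk => ?_
    rw [height_ofPerm_odd σ (Finset.mem_range.1 hk)]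
    omega
  · refine Finset.sum_congr rfl fun k hk => ?_
    rw [height_ofPerm_even σ (by rw [Finset.mem_range] at hk; omega)]
    omega

end DyckPath

/-! ### The path of a noncrossing partition -/

theorem exists_last_before (π : Setoid (Fin n)) {i : Fin n} {k : ℕ} (hik : (i : ℕ) < k) :
    ∃ a, i ≤ a ∧ (a : ℕ) < k ∧ π i a ∧ ∀ b : Fin n, (b : ℕ) < k → π i b → b ≤ a := by
  classical
  obtain ⟨a, ha, hmax⟩ := Finset.exists_max_image
    (Finset.univ.filter fun b : Fin n => (b : ℕ) < k ∧ π i b) (fun b => b)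
    ⟨i, by simp [hik]⟩
  simp only [Finset.mem_filter, Finset.mem_univ, true_and] at ha hmax
  exact ⟨a, hmax i ⟨hik, π.refl i⟩, ha.1, ha.2, fun b hb hr => hmax b ⟨hb, hr⟩⟩

namespace IsSuccPerm

variable {π : Setoid (Fin n)} {σ : Perm (Fin n)}

theorem lt_apply_of_mem_arcsOver (h : IsSuccPerm π σ) (hπ : IsNoncrossing π) {i j a : Fin n}
    (hr : π i j) (ha : a ∈ arcsOver σ i) : j < σ a := by
  obtain ⟨h1, h2⟩ := mem_arcsOver.1 ha
  have hn := h.not_rel_of_lt h1 h2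
  by_contra! hc
  rcases hc.eq_or_lt with hc | hc
  · exact hn (π.trans (h.rel a) (hc ▸ π.symm hr))
  · exact hn (hπ a i (σ a) j h1 h2 hc (h.rel a) hr)

theorem arcsOver_eq (h : IsSuccPerm π σ) (hπ : IsNoncrossing π) {i j : Fin n}
    (hij : i < j) (hr : π i j) : arcsOver σ i = arcsOver σ j := by
  ext a
  refine ⟨fun ha => mem_arcsOver.2 ⟨?_, h.lt_apply_of_mem_arcsOver hπ hr ha⟩, fun ha => ?_⟩
  · exact (mem_arcsOver.1 ha).1.trans hij
  · obtain ⟨h1, h2⟩ := mem_arcsOver.1 ha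
    have hn := h.not_rel_of_lt h1 h2
    refine mem_arcsOver.2 ⟨?_, (Fin.lt_def.1 hij).trans h2⟩
    by_contra! hc
    rcases hc.eq_or_lt with hc | hc
    · exact hn (Fin.ext hc ▸ hr)
    · exact hn (π.trans (π.symm (hπ i a j (σ a) hc h1 h2 hr (h.rel a))) hr)

/-- The arcs over `i` are those over `j`, and they pass over everything between `i` and `j`, so the
heights in between are at least that of `i`. -/
theorem sees_of_rel (h : IsSuccPerm π σ) (hπ : IsNoncrossing π) {i j : Fin n} (hij : i < j)
    (hr : π i j) : (DyckPath.ofPerm σ).Sees i j := by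
  have hij' := Fin.lt_def.1 hij
  refine ⟨?_, fun x hx1 hx2 => ?_⟩
  · rw [DyckPath.height_ofPerm_odd σ i.2, DyckPath.height_ofPerm_odd σ j.2, h.arcsOver_eq hπ hij hr]
  rw [DyckPath.height_ofPerm_odd σ i.2]
  rcases Nat.even_or_odd' x with ⟨k, rfl | rfl⟩
  · rw [DyckPath.height_ofPerm_even σ (by omega)]
    obtain ⟨a, ha1, ha2, ha3, ha4⟩ := exists_last_before π (i := i) (k := k) (by omega)
    -- besides the arcs over `i`, the arc of the block of `i` leaving from `a` passes over the gap
    have hsub : insert a (arcsOver σ i) ⊆ arcsOverGap σ k := by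
      intro b hb
      rw [mem_arcsOverGap]
      rcases Finset.mem_insert.1 hb with rfl | hb
      · refine ⟨ha2, ?_⟩
        have haj := h.next b j (π.trans (π.symm ha3) hr) (Fin.lt_def.2 (by omega))
        by_contra! hc
        exact absurd (ha4 _ hc (π.trans ha3 (h.rel b))) (not_le.2 haj.1)
      · have h1 := (mem_arcsOver.1 hb).1
        have h2 := Fin.lt_def.1 (h.lt_apply_of_mem_arcsOver hπ hr hb)
        omega
    have hc := Finset.card_le_card hsub
    rw [Finset.card_insert_of_notMem (fun hm => by
      have h1 := (mem_arcsOver.1 hm).1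
      have h2 := Fin.le_def.1 ha1
      omega)] at hc
    omega
  · rw [DyckPath.height_ofPerm_odd σ (by omega)]
    have hsub : arcsOver σ i ⊆ arcsOver σ k := fun b hb => by
      have h1 := (mem_arcsOver.1 hb).1
      have h2 := Fin.lt_def.1 (h.lt_apply_of_mem_arcsOver hπ hr hb)
      exact mem_arcsOver.2 ⟨by omega, by omega⟩
    have := Finset.card_le_card hsub
    omega

/-- If `j` were outside the block of `i`, let `a` be the last element before `j` in that block. The
path is up after `a`, so the arc leaving from `a` passes over `j`, as do all arcs over `a`: the
vertex `j` is higher than the vertex `a`, hence than `i`. -/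
theorem rel_of_sees (h : IsSuccPerm π σ) (hπ : IsNoncrossing π) {i j : Fin n} (hij : i < j)
    (hs : (DyckPath.ofPerm σ).Sees i j) : π i j := by
  have hij' := Fin.lt_def.1 hij
  by_contra hr
  obtain ⟨a, ha1, ha2, ha3, ha4⟩ := exists_last_before π (i := i) (k := j) hij'
  have hai : arcsOver σ i = arcsOver σ a := by
    rcases ha1.eq_or_lt with rfl | hlt
    · rfl
    · exact h.arcsOver_eq hπ hlt ha3
  have h1 := hs.2 (2 * (a + 1)) (by have := Fin.le_def.1 ha1; omega) (by omega)
  have h2 := hs.1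
  rw [DyckPath.height_ofPerm_odd σ i.2, DyckPath.height_ofPerm_even σ (by omega), hai,
    card_arcsOverGap_succ] at h1
  rw [DyckPath.height_ofPerm_odd σ i.2, DyckPath.height_ofPerm_odd σ j.2, hai] at h2
  have ha : a < σ a := by
    by_contra hc
    rw [if_neg hc] at h1
    push_cast at h1
    omega
  have hja : j < σ a := by
    by_contra! hc
    rcases hc.eq_or_lt with hc | hc
    · exact hr (π.trans ha3 (hc ▸ h.rel a))
    · exact absurd (ha4 _ (Fin.lt_def.1 hc) (π.trans ha3 (h.rel a))) (not_le.2 ha)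
  have hsub : insert a (arcsOver σ a) ⊆ arcsOver σ j := by
    intro b hb
    rw [mem_arcsOver]
    rcases Finset.mem_insert.1 hb with rfl | hb
    · exact ⟨ha2, hja⟩
    · obtain ⟨h3, h4⟩ := mem_arcsOver.1 hb
      have := Fin.lt_def.1 (h.apply_lt_apply hπ h3 h4)
      have := Fin.lt_def.1 hja
      omega
  have hc := Finset.card_le_card hsub
  rw [Finset.card_insert_of_notMem (by simp [mem_arcsOver])] at hc
  omega

theorem phi_ofPerm (h : IsSuccPerm π σ) (hπ : IsNoncrossing π) :
    (DyckPath.ofPerm σ).phi = ⟨π, hπ⟩ := by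
  refine Subtype.ext (Setoid.ext fun i j => ?_)
  change (DyckPath.ofPerm σ).partition i j ↔ π i j
  rcases lt_trichotomy i j with hij | rfl | hij
  · exact ⟨h.rel_of_sees hπ hij, h.sees_of_rel hπ hij⟩
  · exact ⟨fun _ => π.refl i, fun _ => (DyckPath.partition _).refl i⟩
  · exact ⟨fun hs => π.symm (h.rel_of_sees hπ hij ((DyckPath.partition _).symm hs)),
      fun hr => (DyckPath.partition _).symm (h.sees_of_rel hπ hij (π.symm hr))⟩

end IsSuccPerm

theorem DyckPath.phi_surjective : Function.Surjective (DyckPath.phi (n := n)) := by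
  rintro ⟨π, hπ⟩
  obtain ⟨σ, hσ, -⟩ := exists_isSuccPerm hπ
  exact ⟨_, hσ.phi_ofPerm hπ⟩

/-! ### Rank -/

/-- Cutting blocks one at a time gives a chain of noncrossing partitions of length
`nonmins (phi p)`. -/
theorem DyckPath.nonmins_le_height (p : DyckPath n) :
    (nonmins p.phi.1 : ℕ∞) ≤ Order.height p := by
  induction hk : nonmins p.phi.1 generalizing p with
  | zero => simp
  | succ k ih =>
    have hπ := p.phi.2
    obtain ⟨σ, hσ, -⟩ := exists_isSuccPerm hπ
    obtain ⟨i, j, hij, hr⟩ : ∃ i j, i < j ∧ p.phi.1 i j := by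
      by_contra! hc
      have : nonmins p.phi.1 = 0 := by
        classical
        exact Finset.card_eq_zero.2 (Finset.filter_eq_empty_iff.2
          fun i _ ⟨j, hj, hji⟩ => hc j i hj hji)
      omega
    obtain ⟨p', hp'⟩ := phi_surjective ⟨_, isNoncrossing_split hπ i j⟩
    have hlt : p' < p := by
      change p'.phi < p.phi
      rw [hp']
      exact split_lt hij hr
    have h1 := nonmins_strictMono (split_lt hij hr)
    -- splitting creates only one new block, as a transposition changes the reflection length by
    -- at most one
    have h2 := (hσ.split hπ hij hr).reflLength_eq (isNoncrossing_split hπ i j)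
    have h3 := reflLength_mul_le (σ * swap i j) (swap i j)
    have h4 := reflLength_swap_le hij.ne
    rw [mul_assoc, swap_mul_self, mul_one, hσ.reflLength_eq hπ] at h3
    have h5 := ih p' (by rw [hp']; change nonmins (split _ i j) = k; omega)
    calc ((k + 1 : ℕ) : ℕ∞) = (k : ℕ∞) + 1 := by push_cast; rfl
      _ ≤ Order.height p' + 1 := by gcongr
      _ ≤ Order.height p := Order.height_add_one_le hlt

theorem DyckPath.rk_eq (p : DyckPath n) : p.rk = nonmins p.phi.1 := by
  have hm : StrictMono fun p : DyckPath n => nonmins p.phi.1 := fun p p' h =>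
    nonmins_strictMono (show p.phi.1 < p'.phi.1 from h)
  have h1 := Order.height_le_height_apply_of_strictMono _ hm p
  have h2 : Order.height p = nonmins p.phi.1 :=
    le_antisymm (by simpa using h1) p.nonmins_le_height
  rw [rk, h2, ENat.toNat_natCast]

end NCDyck

/-- `finRotate n` is the `n`-cycle `(1 2 ⋯ n)`: it sends each element to the next one and the last
to the first. -/
theorem corollary1p4 {R : Type*} [CommSemiring R] (q t : R) (n : ℕ) (hn : 1 ≤ n) :
    NCDyck.genFun n q t =
      ∑ σ ∈ NCDyck.absInterval (1 : Equiv.Perm (Fin n)) (finRotate n),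
        q ^ NCDyck.length σ * t ^ NCDyck.reflLength σ := by
  classical
  choose s hs _ using fun p : NCDyck.DyckPath n => NCDyck.exists_isSuccPerm p.phi.2
  refine Finset.sum_bij (fun p _ => s p) (fun p _ => ?_) (fun p _ p' _ h => ?_) (fun ρ hρ => ?_)
    (fun p _ => ?_)
  · refine Finset.mem_filter.2 ⟨Finset.mem_univ _, ?_, (hs p).absLE p.phi.2⟩
    simp [NCDyck.AbsLE, NCDyck.reflLength_one]
  · have hp := hs p
    rw [h] at hp
    exact NCDyck.DyckPath.phi_injective (Subtype.ext (hp.setoid_unique (hs p')))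
  · obtain ⟨π, hπ, hρπ⟩ := NCDyck.exists_isSuccPerm_of_absLE (Finset.mem_filter.1 hρ).2.2
    obtain ⟨p, hp⟩ := NCDyck.DyckPath.phi_surjective ⟨π, hπ⟩
    refine ⟨p, Finset.mem_univ _, (hs p).unique ?_⟩
    rw [hp]
    exact hρπ
  · have hp : p = NCDyck.DyckPath.ofPerm (s p) :=
      NCDyck.DyckPath.phi_injective ((hs p).phi_ofPerm p.phi.2).symm
    have harea : p.area = NCDyck.length (s p) := by
      rw [(hs p).length_eq p.phi.2, ← NCDyck.DyckPath.area_ofPerm, ← hp]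
    rw [harea, p.rk_eq, (hs p).reflLength_eq p.phi.2]
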